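/- Let $B_3=\langle \sigma_1,\sigma_2 : \sigma_1\sigma_2\sigma_1=\sigma_2\sigma_1\sigma_2\rangle$ be the braid group on three strands and let $\Delta=\sigma_1\sigma_2\sigma_1$ be its Garside element. A positive half-twist in $B_3$ is a conjugate of $\sigma_1$. A factorization of $g\in B_3$ is a finite sequence $(g_1,\dots,g_k)$ of elements of $B_3$ with $g_1g_2\cdots g_k=g$. A Hurwitz move on a factorization replaces two adjacent factors $(g_j,g_{j+1})$ by $(g_jg_{j+1}g_j^{-1},\,g_j)$ or by $(g_{j+1},\,g_{j+1}^{-1}g_jg_{j+1})$. A global conjugation move by $h\in B_3$ on a factorization of a central element replaces $(g_1,\dots,g_k)$ by $(hg_1h^{-1},\dots,hg_kh^{-1})$. Two factorizations of a central element (such as $\Delta^2$) are Hurwitz equivalent if one is obtained from the other by a finite sequence of Hurwitz moves and global conjugation moves. Theorem. Let $\mathcal F$ be a factorization of $\Delta^2$ in $B_3$ into four factors, of which, in some order, three are positive half-twists and one is the cube of a positive half-twist. Then $\mathcal F$ is Hurwitz equivalent to the factorization $(\sigma_1^3,\ \sigma_1^{-1}\sigma_2\sigma_1,\ \sigma_1,\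 \sigma_2)$ of $\Delta^2$. -/

import Mathlib

namespace Braid3

/-- The relators of the Artin presentation on two generators (indexed by `0` and `1`):
the single relation `s₀ s₁ s₀ = s₁ s₀ s₁`. -/
def relators : Set (FreeGroup (Fin 2)) :=
  {FreeGroup.of 0 * FreeGroup.of 1 * FreeGroup.of 0 *
    (FreeGroup.of 1 * FreeGroup.of 0 * FreeGroup.of 1)⁻¹}

/-- The braid group on three strands, `⟨σ₁, σ₂ : σ₁ σ₂ σ₁ = σ₂ σ₁ σ₂⟩`. -/
abbrev B₃ : Type := PresentedGroup relators

/-- The first Artin generator. -/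
def σ₁ : B₃ := PresentedGroup.of 0

/-- The second Artin generator. -/
def σ₂ : B₃ := PresentedGroup.of 1

/-- The Garside element `Δ = σ₁ σ₂ σ₁`. -/
def Δ : B₃ := σ₁ * σ₂ * σ₁

/-- The positive half-twists are the conjugates of the Artin generator `σ₁`. -/
def IsPositiveHalfTwist (g : B₃) : Prop := IsConj σ₁ g

end Braid3

/-- A factorization `(g₁, …, g_k)` in a group is a list of elements; it is a factorization of
its product. This is a single Hurwitz move, in either direction, or, if the product is central,
a single global conjugation move. -/
inductive HurwitzStep {G : Type*} [Group G] : List G → List G → Prop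
  | left (L M : List G) (a b : G) :
      HurwitzStep (L ++ a :: b :: M) (L ++ (a * b * a⁻¹) :: a :: M)
  | right (L M : List G) (a b : G) :
      HurwitzStep (L ++ a :: b :: M) (L ++ b :: (b⁻¹ * a * b) :: M)
  | conj (F : List G) (h : G) (hF : F.prod ∈ Subgroup.center G) :
      HurwitzStep F (F.map fun g => h * g * h⁻¹)

/-- Hurwitz equivalence: a finite sequence of Hurwitz moves, together with global conjugation
moves when the factored element is central. -/
def HurwitzEquivalent {G : Type*} [Group G] (F F' : List G) : Prop :=
  Relation.ReflTransGen HurwitzStep F F'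

namespace Braid3

/-! ### Generalities on Hurwitz equivalence -/

/-! Hurwitz moves bring the cube to the front and a global conjugation makes it `σ₁ ^ 3`, leaving
half-twists `a`, `b`, `c` with `a * b * c = σ₁⁻³ Δ²`. In `SL(2, ℤ)` these are transvections along
integer vectors; let `x`, `y`, `z` be the determinants of the pairs `(a, b)`, `(b, c)`, `(a, c)`.
Taking traces gives the Markov-type equation `x² + y² + z² + xyz = 4`, on which Hurwitz moves act,
up to sign and order, by Vieta involutions. Descent (`vieta_descent`) reaches a solution with an
entry `±2`, which a further move or two makes `x`. There traces force `c = σ₁`, and conjugation by a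
power of `σ₁` fixes the rest (`hurwitz_of_eq_two`).

Matrix identities lift to braids because matrices `±1` come only from central braids, so that a
half-twist with the matrix of `σ₁` or `σ₂` equals it. Any two factorizations of the given type thus
share one normal form. -/

theorem _root_.HurwitzStep.prod_eq {G : Type*} [Group G] {F F' : List G}
    (h : HurwitzStep F F') : F'.prod = F.prod := by
  cases h with
  | left L M a b => simp [mul_assoc]
  | right L M a b => simp [mul_assoc]
  | conj F h hF =>
    have key : ∀ F : List G, (F.map fun g => h * g * h⁻¹).prod = h * F.prod * h⁻¹ := by
      intro F
      induction F with
      | nil => simp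
      | cons a F ih => simp only [List.map_cons, List.prod_cons, ih]; group
    rw [key, Subgroup.mem_center_iff.mp hF h, mul_inv_cancel_right]

theorem _root_.HurwitzStep.symm {G : Type*} [Group G] {F F' : List G}
    (h : HurwitzStep F F') : HurwitzStep F' F := by
  have hp := h.prod_eq
  cases h with
  | left L M a b =>
    have := HurwitzStep.right L M (a * b * a⁻¹) a
    simpa [mul_assoc] using this
  | right L M a b =>
    have := HurwitzStep.left L M b (b⁻¹ * a * b)
    simpa [mul_assoc] using this
  | conj F h hF =>
    have := HurwitzStep.conj (F.map fun g => h * g * h⁻¹) h⁻¹ (by rwa [hp])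
    simpa [mul_assoc, Function.comp_def] using this

theorem _root_.HurwitzEquivalent.symm {G : Type*} [Group G] {F F' : List G}
    (h : HurwitzEquivalent F F') : HurwitzEquivalent F' F := by
  induction h with
  | refl => exact Relation.ReflTransGen.refl
  | tail _ h ih => exact Relation.ReflTransGen.head h.symm ih

theorem _root_.HurwitzEquivalent.trans {G : Type*} [Group G] {F F' F'' : List G}
    (h : HurwitzEquivalent F F') (h' : HurwitzEquivalent F' F'') : HurwitzEquivalent F F'' :=
  Relation.ReflTransGen.trans h h'

theorem _root_.HurwitzEquivalent.prod_eq {G : Type*} [Group G] {F F' : List G}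
    (h : HurwitzEquivalent F F') : F'.prod = F.prod := by
  induction h with
  | refl => rfl
  | tail _ h ih => rw [h.prod_eq, ih]

/-- Any factor can be moved to the front by Hurwitz moves, conjugating the factors it passes. -/
theorem _root_.HurwitzEquivalent.exists_move_to_front {G : Type*} [Group G] {P : G → Prop}
    (hP : ∀ g h, P g → P (h * g * h⁻¹)) (x : G) (L M : List G)
    (hL : ∀ g ∈ L, P g) (hM : ∀ g ∈ M, P g) :
    ∃ N : List G, HurwitzEquivalent (L ++ x :: M) (x :: N) ∧ (∀ g ∈ N, P g) ∧
      N.length = L.length + M.length := by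
  induction L using List.reverseRecOn generalizing M with
  | nil => exact ⟨M, Relation.ReflTransGen.refl, hM, by simp⟩
  | append_singleton L a ih =>
    obtain ⟨N, hN, hPN, hlen⟩ := ih ((x⁻¹ * a * x) :: M) (fun g hg => hL g (by simp [hg])) (by
      intro g hg
      rcases List.mem_cons.mp hg with rfl | hg
      · simpa using hP a x⁻¹ (hL a (by simp))
      · exact hM g hg)
    refine ⟨N, ?_, hPN, by simp [hlen]; omega⟩
    refine Relation.ReflTransGen.head ?_ hN
    simpa using HurwitzStep.right L M a x

/-! ### Relations in the braid group -/

theorem braid_relation : σ₁ * σ₂ * σ₁ = σ₂ * σ₁ * σ₂ := by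
  have h : (PresentedGroup.mk relators) (FreeGroup.of 0 * FreeGroup.of 1 * FreeGroup.of 0 *
    (FreeGroup.of 1 * FreeGroup.of 0 * FreeGroup.of 1)⁻¹) = 1 :=
    PresentedGroup.one_of_mem (by rw [relators]; rfl)
  rw [map_mul, map_inv, mul_inv_eq_one] at h
  exact h

theorem Δ_mul_σ₁ : Δ * σ₁ = σ₂ * Δ := by
  rw [Δ]; nth_rw 1 [braid_relation]; simp only [mul_assoc]

theorem Δ_mul_σ₂ : Δ * σ₂ = σ₁ * Δ := by
  rw [Δ]; nth_rw 2 [braid_relation]; simp only [mul_assoc]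

theorem induction_on_generators {p : B₃ → Prop} (one : p 1)
    (h₁ : ∀ g, p g → p (σ₁ * g)) (h₁' : ∀ g, p g → p (σ₁⁻¹ * g))
    (h₂ : ∀ g, p g → p (σ₂ * g)) (h₂' : ∀ g, p g → p (σ₂⁻¹ * g)) (g : B₃) : p g := by
  have hg : g ∈ Subgroup.closure (Set.range (PresentedGroup.of (rels := relators))) := by
    rw [PresentedGroup.closure_range_of]; trivial
  induction hg using Subgroup.closure_induction_left with
  | one => exact one
  | mul_left x hx y _ ih =>
    obtain ⟨i, rfl⟩ := hx
    fin_cases i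
    · exact h₁ _ ih
    · exact h₂ _ ih
  | inv_mul_cancel x hx y _ ih =>
    obtain ⟨i, rfl⟩ := hx
    fin_cases i
    · exact h₁' _ ih
    · exact h₂' _ ih

theorem Δ_sq_mem_center : Δ ^ 2 ∈ Subgroup.center B₃ := by
  have e₁ : Commute (Δ ^ 2) σ₁ := by
    rw [commute_iff_eq, pow_two, mul_assoc, Δ_mul_σ₁, ← mul_assoc, Δ_mul_σ₂, mul_assoc]
  have e₂ : Commute (Δ ^ 2) σ₂ := by
    rw [commute_iff_eq, pow_two, mul_assoc, Δ_mul_σ₂, ← mul_assoc, Δ_mul_σ₁, mul_assoc]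
  rw [Subgroup.mem_center_iff]
  intro g
  suffices Commute (Δ ^ 2) g from this.eq.symm
  induction g using induction_on_generators with
  | one => exact Commute.one_right _
  | h₁ g h => exact e₁.mul_right h
  | h₁' g h => exact e₁.inv_right.mul_right h
  | h₂ g h => exact e₂.mul_right h
  | h₂' g h => exact e₂.inv_right.mul_right h

theorem Δ_sq_zpow_mem_center (k : ℤ) : (Δ ^ 2) ^ k ∈ Subgroup.center B₃ :=
  Subgroup.zpow_mem _ Δ_sq_mem_center k

theorem commute_Δ_sq (g : B₃) : Commute (Δ ^ 2) g :=
  (Subgroup.mem_center_iff.mp Δ_sq_mem_center g).symm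

theorem Δ_mul_σ₁_mul_σ₂ : Δ * (σ₁ * σ₂) = Δ ^ 2 * σ₁⁻¹ := by
  rw [eq_mul_inv_iff_mul_eq, pow_two]
  simp only [Δ, mul_assoc]

theorem Δ_mul_σ₁_mul_σ₂_sq : Δ * (σ₁ * σ₂) ^ 2 = Δ ^ 2 * σ₂ := by
  rw [pow_two, ← mul_assoc, Δ_mul_σ₁_mul_σ₂]
  group

theorem σ₁_mul_σ₂_cube : (σ₁ * σ₂) ^ 3 = Δ ^ 2 := by
  rw [pow_succ', pow_two]
  nth_rw 1 [pow_two]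
  nth_rw 1 [Δ]
  rw [Δ, braid_relation]
  nth_rw 1 [← braid_relation]
  simp only [mul_assoc]

/-! ### The representation in `SL(2, ℤ)` -/

/-- The reduced Burau representation at `-1`. -/
def toSL2 : B₃ →* Matrix.SpecialLinearGroup (Fin 2) ℤ :=
  PresentedGroup.toGroup
    (f := ![ModularGroup.T, ⟨!![1, 0; -1, 1], by simp [Matrix.det_fin_two]⟩]) (by
      intro r hr
      rw [relators, Set.mem_singleton_iff] at hr
      subst hr
      simp only [map_mul, map_inv, FreeGroup.lift_apply_of, mul_inv_eq_one]
      apply Subtype.ext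
      change !![1, 1; 0, 1] * !![1, 0; -1, 1] * !![1, 1; 0, 1] =
        (!![1, 0; -1, 1] * !![1, 1; 0, 1] * !![1, 0; -1, 1] : Matrix (Fin 2) (Fin 2) ℤ)
      simp)

/-- The integer matrix of a braid. -/
def mat (g : B₃) : Matrix (Fin 2) (Fin 2) ℤ := (toSL2 g : Matrix (Fin 2) (Fin 2) ℤ)

theorem mat_mul (g h : B₃) : mat (g * h) = mat g * mat h := by simp [mat]

theorem mat_one : mat 1 = 1 := by simp [mat]

theorem mat_pow (g : B₃) (n : ℕ) : mat (g ^ n) = mat g ^ n := by simp [mat]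

theorem mat_inv (g : B₃) :
    mat g⁻¹ = !![mat g 1 1, -mat g 0 1; -mat g 1 0, mat g 0 0] := by
  rw [mat, map_inv, Matrix.SpecialLinearGroup.SL2_inv_expl]
  rfl

theorem mat_det (g : B₃) : mat g 0 0 * mat g 1 1 - mat g 0 1 * mat g 1 0 = 1 := by
  rw [← Matrix.det_fin_two]; exact (toSL2 g).2

theorem mat_σ₁ : mat σ₁ = !![1, 1; 0, 1] := by
  simp [mat, toSL2, σ₁, ModularGroup.T]

theorem mat_σ₂ : mat σ₂ = !![1, 0; -1, 1] := by
  simp [mat, toSL2, σ₂]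

theorem mat_σ₁_zpow (n : ℤ) : mat (σ₁ ^ n) = !![1, n; 0, 1] := by
  have : toSL2 σ₁ = ModularGroup.T := by simp [toSL2, σ₁]
  rw [mat, map_zpow, this, ModularGroup.coe_T_zpow]

theorem mat_Δ : mat Δ = !![0, 1; -1, 0] := by
  simp [Δ, mat_mul, mat_σ₁, mat_σ₂]

theorem mat_Δ_sq : mat (Δ ^ 2) = -1 := by
  rw [mat_pow, mat_Δ, pow_two, Matrix.mul_fin_two, Matrix.one_fin_two]
  simp

theorem mat_Δ_sq_zpow (k : ℤ) : mat ((Δ ^ 2) ^ k) = 1 ∨ mat ((Δ ^ 2) ^ k) = -1 := by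
  induction k with
  | zero => left; simp [mat_one]
  | succ k ih =>
    rw [zpow_add_one, mat_mul, mat_Δ_sq]
    rcases ih with h | h <;> rw [h] <;> simp
  | pred k ih =>
    have : mat (Δ ^ 2)⁻¹ = -1 := by
      rw [mat_inv, mat_Δ_sq, Matrix.one_fin_two]; simp
    rw [zpow_sub_one, mat_mul, this]
    rcases ih with h | h <;> rw [h] <;> simp

/-! ### The kernel of the representation is central -/

/-- The submonoid generated by `σ₁⁻¹` and `σ₂`. -/
def alternatingMonoid : Submonoid B₃ := Submonoid.closure {σ₁⁻¹, σ₂}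

/-- Both generators have unit diagonal and nonpositive off-diagonal entries, so nothing cancels in
products. The last clause detects nontrivial `P`. -/
theorem mat_of_mem_alternatingMonoid {P : B₃} (hP : P ∈ alternatingMonoid) :
    1 ≤ mat P 0 0 ∧ 1 ≤ mat P 1 1 ∧ mat P 0 1 ≤ 0 ∧ mat P 1 0 ≤ 0 ∧
      (P = 1 ∨ mat P 0 1 + mat P 1 0 ≤ -1) := by
  induction hP using Submonoid.closure_induction_left with
  | one => simp [mat_one]
  | mul_left x hx y _ ih =>
    obtain ⟨h1, h2, h3, h4, h5⟩ := ih
    rcases hx with rfl | rfl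
    · simp only [mat_mul, mat_inv, mat_σ₁, Matrix.mul_apply, Fin.sum_univ_two]
      simp
      refine ⟨by linarith, h2, by linarith, h4, Or.inr (by linarith)⟩
    · simp only [mat_mul, mat_σ₂, Matrix.mul_apply, Fin.sum_univ_two]
      simp
      refine ⟨h1, by linarith, h3, by linarith, Or.inr (by linarith)⟩

/-- Every braid is `Δ²ᵏ (σ₁ σ₂)ⁱ P Δʲ` with `P` a product of copies of `σ₁⁻¹` and `σ₂`. -/
def HasNormalForm (g : B₃) : Prop :=
  ∃ (k : ℤ) (i j : ℕ) (P : B₃), i < 3 ∧ j < 2 ∧ P ∈ alternatingMonoid ∧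
    g = (Δ ^ 2) ^ k * ((σ₁ * σ₂) ^ i * P * Δ ^ j)

theorem HasNormalForm.central_mul {g : B₃} (h : HasNormalForm g) (k : ℤ) :
    HasNormalForm ((Δ ^ 2) ^ k * g) := by
  obtain ⟨l, i, j, P, hi, hj, hP, rfl⟩ := h
  exact ⟨k + l, i, j, P, hi, hj, hP, by rw [zpow_add, mul_assoc ((Δ ^ 2) ^ k)]⟩

theorem HasNormalForm.t_mul {g : B₃} (h : HasNormalForm g) : HasNormalForm (σ₁ * σ₂ * g) := by
  obtain ⟨l, i, j, P, hi, hj, hP, rfl⟩ := h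
  rw [((commute_Δ_sq (σ₁ * σ₂)).symm.zpow_right l).left_comm]
  refine HasNormalForm.central_mul ?_ l
  by_cases h2 : i = 2
  · refine ⟨1, 0, j, P, by norm_num, hj, hP, ?_⟩
    subst h2
    rw [zpow_one, ← σ₁_mul_σ₂_cube]
    group
  · exact ⟨0, i + 1, j, P, by omega, hj, hP, by rw [pow_succ' _ i]; simp only [zpow_zero, one_mul, mul_assoc]⟩

/-- Modulo `Δ²`, the elements `Δ` and `t = σ₁ σ₂` have orders dividing 2 and 3, with `Δ t` and `Δ
t²` equal to `σ₁⁻¹` and `σ₂`. So `Δ` either turns a prefix `tⁱ` into a letter of `P`, or turns the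
first letter of `P` into a prefix. -/
theorem HasNormalForm.Δ_mul {g : B₃} (h : HasNormalForm g) : HasNormalForm (Δ * g) := by
  obtain ⟨l, i, j, P, hi, hj, hP, rfl⟩ := h
  rw [((commute_Δ_sq Δ).symm.zpow_right l).left_comm]
  refine HasNormalForm.central_mul ?_ l
  have hσ₁ : σ₁⁻¹ ∈ alternatingMonoid := Submonoid.subset_closure (by simp)
  have hσ₂ : σ₂ ∈ alternatingMonoid := Submonoid.subset_closure (by simp)
  interval_cases i
  · induction hP using Submonoid.closure_induction_left with
    | one =>
      interval_cases j
      · exact ⟨0, 0, 1, 1, by norm_num, by norm_num, one_mem _, by simp⟩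
      · exact ⟨1, 0, 0, 1, by norm_num, by norm_num, one_mem _, by simp [pow_two]⟩
    | mul_left x hx y hy ih =>
      rcases hx with rfl | rfl
      · refine ⟨0, 1, j, y, by norm_num, hj, hy, ?_⟩
        have : Δ * σ₁⁻¹ = σ₁ * σ₂ := by simp [Δ]
        simp only [← mul_assoc, pow_zero, pow_one, zpow_zero, one_mul, this]
      · refine ⟨0, 2, j, y, by norm_num, hj, hy, ?_⟩
        have : Δ * σ₂ = (σ₁ * σ₂) ^ 2 := by simp [Δ, pow_two, mul_assoc]
        simp only [← mul_assoc, pow_zero, zpow_zero, one_mul, this]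
  · refine ⟨1, 0, j, σ₁⁻¹ * P, by norm_num, hj, mul_mem hσ₁ hP, ?_⟩
    simp only [← mul_assoc, pow_zero, mul_one, pow_one, zpow_one]
    rw [mul_assoc Δ σ₁ σ₂, Δ_mul_σ₁_mul_σ₂]
  · refine ⟨1, 0, j, σ₂ * P, by norm_num, hj, mul_mem hσ₂ hP, ?_⟩
    simp only [← mul_assoc, pow_zero, mul_one, zpow_one]
    rw [Δ_mul_σ₁_mul_σ₂_sq]

theorem hasNormalForm (g : B₃) : HasNormalForm g := by
  have ht' {g : B₃} (h : HasNormalForm g) : HasNormalForm ((σ₁ * σ₂)⁻¹ * g) := by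
    have := (h.t_mul.t_mul).central_mul (-1)
    rwa [← mul_assoc (σ₁ * σ₂), ← mul_assoc, zpow_neg_one, ← σ₁_mul_σ₂_cube,
      show ((σ₁ * σ₂) ^ 3)⁻¹ * (σ₁ * σ₂ * (σ₁ * σ₂)) = (σ₁ * σ₂)⁻¹ by
        generalize σ₁ * σ₂ = t; group] at this
  have hs' {g : B₃} (h : HasNormalForm g) : HasNormalForm (Δ⁻¹ * g) := by
    have := h.Δ_mul.central_mul (-1)
    rwa [← mul_assoc, zpow_neg_one, show (Δ ^ 2)⁻¹ * Δ = Δ⁻¹ by group] at this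
  have e₁ : σ₁ = (σ₁ * σ₂)⁻¹ * Δ := by simp [Δ, mul_assoc]
  have e₂ : σ₂ = Δ * (σ₁ * σ₂)⁻¹ := by
    rw [Δ, braid_relation]; group
  induction g using induction_on_generators with
  | one => exact ⟨0, 0, 0, 1, by norm_num, by norm_num, one_mem _, by simp⟩
  | h₁ g h => rw [e₁, mul_assoc]; exact ht' h.Δ_mul
  | h₁' g h => rw [e₁, mul_inv_rev, inv_inv, mul_assoc]; exact hs' h.t_mul
  | h₂ g h => rw [e₂, mul_assoc]; exact (ht' h).Δ_mul
  | h₂' g h => rw [e₂, mul_inv_rev, inv_inv, mul_assoc]; exact (hs' h).t_mul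

theorem mem_center_of_mat_eq_one_or_neg_one {g : B₃} (hg : mat g = 1 ∨ mat g = -1) :
    g ∈ Subgroup.center B₃ := by
  obtain ⟨k, i, j, P, hi, hj, hP, rfl⟩ := hasNormalForm g
  obtain ⟨h1, h2, h3, h4, h5⟩ := mat_of_mem_alternatingMonoid hP
  have key : mat ((σ₁ * σ₂) ^ i * P * Δ ^ j) = 1 ∨ mat ((σ₁ * σ₂) ^ i * P * Δ ^ j) = -1 := by
    rw [mat_mul] at hg
    rcases mat_Δ_sq_zpow k with h | h <;> rw [h] at hg <;> rcases hg with hg | hg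
    · left; simpa using hg
    · right; simpa using hg
    · right; simpa [neg_eq_iff_eq_neg] using hg
    · left; simpa using hg
  suffices h : i = 0 ∧ j = 0 ∧ P = 1 by
    obtain ⟨rfl, rfl, rfl⟩ := h
    simpa using Δ_sq_zpow_mem_center k
  rw [mat_mul, mat_mul, mat_pow, mat_pow, mat_mul, mat_σ₁, mat_σ₂, mat_Δ,
    Matrix.eta_fin_two (mat P), Matrix.one_fin_two] at key
  interval_cases i <;> interval_cases j <;>
    simp [pow_two] at key ⊢ <;>
    rcases h5 with h5 | h5 <;> first | exact h5 | omega

/-! ### Half-twists and transvections -/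

theorem IsPositiveHalfTwist.conj {a : B₃} (ha : IsPositiveHalfTwist a) (h : B₃) :
    IsPositiveHalfTwist (h * a * h⁻¹) :=
  IsConj.trans ha (isConj_iff.mpr ⟨h, rfl⟩)

theorem isPositiveHalfTwist_σ₁ : IsPositiveHalfTwist σ₁ := IsConj.refl _

theorem isPositiveHalfTwist_σ₂ : IsPositiveHalfTwist σ₂ :=
  isConj_iff.mpr ⟨Δ, by rw [Δ_mul_σ₁, mul_inv_cancel_right]⟩

/-- `a` is a half-twist whose matrix is the transvection along `(p, q)`. -/
def HasVector (a : B₃) (p q : ℤ) : Prop :=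
  IsPositiveHalfTwist a ∧ mat a = !![1 - p * q, p ^ 2; -q ^ 2, 1 + p * q]

theorem IsPositiveHalfTwist.exists_hasVector {a : B₃} (ha : IsPositiveHalfTwist a) :
    ∃ p q, HasVector a p q := by
  obtain ⟨g, rfl⟩ := isConj_iff.mp ha
  refine ⟨mat g 0 0, mat g 1 0, ha, ?_⟩
  have hd := mat_det g
  rw [mat_mul, mat_mul, mat_inv, mat_σ₁]
  rw [Matrix.eta_fin_two (mat g)]
  simp
  refine ⟨⟨?_, ?_⟩, ?_, ?_⟩
  · linear_combination hd
  · ring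
  · ring
  · linear_combination hd

/-- A half-twist is determined by its matrix; here for the half-twists fixing the direction
of `σ₁`. -/
theorem IsPositiveHalfTwist.eq_σ₁ {a : B₃} (ha : IsPositiveHalfTwist a) (h : mat a 1 0 = 0) :
    a = σ₁ := by
  obtain ⟨g, rfl⟩ := isConj_iff.mp ha
  have hd := mat_det g
  have hq : mat g 1 0 = 0 := by
    rw [mat_mul, mat_mul, mat_inv, mat_σ₁, Matrix.eta_fin_two (mat g)] at h
    simp at h
    nlinarith
  rw [hq, mul_zero, sub_zero] at hd
  -- `mat g` is upper triangular with equal diagonal entries `±1`; this power of `σ₁` clears the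
  -- corner.
  have hc : g * σ₁ ^ (-(mat g 0 0 * mat g 0 1)) ∈ Subgroup.center B₃ := by
    apply mem_center_of_mat_eq_one_or_neg_one
    rw [mat_mul, mat_σ₁_zpow, Matrix.eta_fin_two (mat g), hq, Matrix.one_fin_two]
    rcases Int.eq_one_or_neg_one_of_mul_eq_one' hd with ⟨h1, h2⟩ | ⟨h1, h2⟩ <;>
      simp [h1, h2]
  have hcomm : Commute (g * σ₁ ^ (-(mat g 0 0 * mat g 0 1))) σ₁ :=
    (Subgroup.mem_center_iff.mp hc σ₁).symm
  have hg : Commute g σ₁ := by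
    have := hcomm.mul_left ((Commute.refl σ₁).zpow_left (mat g 0 0 * mat g 0 1))
    rwa [mul_assoc, ← zpow_add, neg_add_cancel, zpow_zero, mul_one] at this
  rw [hg.eq, mul_inv_cancel_right]

theorem IsPositiveHalfTwist.eq_σ₂ {a : B₃} (ha : IsPositiveHalfTwist a) (h : mat a = mat σ₂) :
    a = σ₂ := by
  have h1 : Δ⁻¹ * a * Δ⁻¹⁻¹ = σ₁ := by
    apply (ha.conj Δ⁻¹).eq_σ₁
    simp [mat_mul, h, mat_inv, mat_Δ, mat_σ₂]
  have h2 : a = Δ * σ₁ * Δ⁻¹ := by rw [← h1]; group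
  rw [h2, Δ_mul_σ₁, mul_inv_cancel_right]

theorem HasVector.conj_mul {a b : B₃} {p q r s : ℤ} (ha : HasVector a p q)
    (hb : HasVector b r s) :
    HasVector (a * b * a⁻¹) (r + (p * s - q * r) * p) (s + (p * s - q * r) * q) := by
  refine ⟨hb.1.conj a, ?_⟩
  rw [mat_mul, mat_mul, mat_inv, ha.2, hb.2]
  simp
  refine ⟨⟨?_, ?_⟩, ?_, ?_⟩ <;> ring

theorem HasVector.inv_conj_mul {a b : B₃} {p q r s : ℤ} (ha : HasVector a p q)
    (hb : HasVector b r s) :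
    HasVector (a⁻¹ * b * a) (r - (p * s - q * r) * p) (s - (p * s - q * r) * q) := by
  refine ⟨by simpa using hb.1.conj a⁻¹, ?_⟩
  rw [mat_mul, mat_mul, mat_inv, ha.2, hb.2]
  simp
  refine ⟨⟨?_, ?_⟩, ?_, ?_⟩ <;> ring

/-! ### Vieta descent -/

/-- As a quadratic in `z`, the equation has second root `x * y - z`, positive because the product of
the roots is `x² + y² - 4`. The quadratic is negative at `y`, so `y` separates the roots. -/
theorem vieta_lt {x y z : ℤ} (hx : 3 ≤ x) (hxy : x ≤ y) (hyz : y ≤ z)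
    (h : x ^ 2 + y ^ 2 + z ^ 2 = x * y * z + 4) : |z - x * y| < z := by
  have hpos : 0 < x * y - z := by
    have : 0 < z * (x * y - z) := by nlinarith
    exact pos_of_mul_pos_right this (by linarith)
  have hneg : (y - z) * (y - (x * y - z)) < 0 := by
    have e : (y - z) * (y - (x * y - z)) = (x - 2) * (x + 2 - y ^ 2) := by
      linear_combination -h
    rw [e]
    exact mul_neg_of_pos_of_neg (by linarith) (by nlinarith)
  have : 0 < y - (x * y - z) := by
    by_contra! hle
    nlinarith [mul_nonneg_of_nonpos_of_nonpos (sub_nonpos.mpr hyz) hle]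
  rw [abs_lt]
  constructor <;> linarith

theorem vieta_descent_of_le {x y z : ℤ} (hx : 3 ≤ |x|) (hxy : |x| ≤ |y|) (hyz : |y| ≤ |z|)
    (h : x ^ 2 + y ^ 2 + z ^ 2 + x * y * z = 4) : |z + x * y| < |z| := by
  have habs : |x * y * z| = |x| * |y| * |z| := by rw [abs_mul, abs_mul]
  have hxyz : x * y * z < 0 := by
    nlinarith [sq_abs x, sq_abs y, sq_abs z]
  have heq : |x| ^ 2 + |y| ^ 2 + |z| ^ 2 = |x| * |y| * |z| + 4 := by
    rw [← habs, abs_of_neg hxyz, sq_abs, sq_abs, sq_abs]; linarith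
  have hlt := vieta_lt hx hxy hyz heq
  have : |z + x * y| = |(|z| - |x| * |y|)| := by
    rw [← abs_mul]
    rcases lt_trichotomy z 0 with hz | hz | hz
    · have : 0 < x * y := pos_of_mul_neg_left hxyz hz.le
      rw [abs_of_neg hz, abs_of_pos this, ← abs_neg]; ring_nf
    · simp [hz] at hxyz
    · have : x * y < 0 := neg_of_mul_neg_left hxyz hz.le
      rw [abs_of_pos hz, abs_of_neg this]; ring_nf
  rwa [this]

theorem vieta_small {x y z : ℤ} (hx : |x| < 3) (h : x ^ 2 + y ^ 2 + z ^ 2 + x * y * z = 4) :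
    |x| = 2 ∨ |y| = 2 ∨ |z| = 2 ∨ |z + x * y| = 2 := by
  obtain ⟨h1, h2⟩ := abs_lt.mp hx
  have hx' : x = -2 ∨ x = 2 ∨ x = -1 ∨ x = 0 ∨ x = 1 := by omega
  rcases hx' with rfl | rfl | rfl | rfl | rfl
  · simp
  · simp
  -- For `|x| ≤ 1` the form `y² + z² + xyz` is positive definite, leaving finitely many cases.
  all_goals
    have hy1 : y ≤ 2 := by nlinarith [sq_nonneg (2 * z + y), sq_nonneg (2 * z - y), sq_nonneg z]
    have hy2 : -2 ≤ y := by nlinarith [sq_nonneg (2 * z + y), sq_nonneg (2 * z - y), sq_nonneg z]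
    have hz1 : z ≤ 2 := by nlinarith [sq_nonneg (2 * y + z), sq_nonneg (2 * y - z), sq_nonneg y]
    have hz2 : -2 ≤ z := by nlinarith [sq_nonneg (2 * y + z), sq_nonneg (2 * y - z), sq_nonneg y]
    interval_cases y <;> interval_cases z <;> simp at h ⊢

theorem vieta_descent {x y z : ℤ} (h : x ^ 2 + y ^ 2 + z ^ 2 + x * y * z = 4) :
    |x| = 2 ∨ |y| = 2 ∨ |z| = 2 ∨ |z + x * y| = 2 ∨ |x + y * z| = 2 ∨
      |z + x * y| < |z| ∨ |y + x * z| < |y| ∨ |x + y * z| < |x| := by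
  by_cases hx : |x| < 3
  · have := vieta_small hx h
    rcases this with h | h | h | h <;> simp only [h, true_or, or_true]
  by_cases hy : |y| < 3
  · have := vieta_small (x := y) (y := z) (z := x) hy (by linarith)
    rcases this with h | h | h | h <;> simp only [h, true_or, or_true]
  by_cases hz : |z| < 3
  · have := vieta_small (x := z) (y := y) (z := x) hz (by linarith)
    rw [mul_comm z y] at this
    rcases this with h | h | h | h <;> simp only [h, true_or, or_true]
  push Not at hx hy hz
  have hx' : |y| ≤ |x| → |z| ≤ |x| → |x + y * z| < |x| := fun h1 h2 => by
    rcases le_total |y| |z| with h3 | h3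
    · exact vieta_descent_of_le hy h3 h2 (by linarith)
    · rw [mul_comm]; exact vieta_descent_of_le hz h3 h1 (by linarith)
  have hy' : |x| ≤ |y| → |z| ≤ |y| → |y + x * z| < |y| := fun h1 h2 => by
    rcases le_total |x| |z| with h3 | h3
    · exact vieta_descent_of_le hx h3 h2 (by linarith)
    · rw [mul_comm]; exact vieta_descent_of_le hz h3 h1 (by linarith)
  have hz' : |x| ≤ |z| → |y| ≤ |z| → |z + x * y| < |z| := fun h1 h2 => by
    rcases le_total |x| |y| with h3 | h3
    · exact vieta_descent_of_le hx h3 h2 (by linarith)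
    · rw [mul_comm]; exact vieta_descent_of_le hy h3 h1 (by linarith)
  rcases le_total |x| |y| with h1 | h1
  · rcases le_total |y| |z| with h2 | h2
    · simp only [hz' (h1.trans h2) h2, true_or, or_true]
    · simp only [hy' h1 h2, true_or, or_true]
  · rcases le_total |x| |z| with h3 | h3
    · simp only [hz' h3 (h1.trans h3), true_or, or_true]
    · simp only [hx' h1 h3, or_true]

/-! ### Reduction to a normal form -/

/-- The factorization to which all others are reduced. -/
def normalFactorization : List B₃ := [σ₁ ^ 3, σ₂, σ₂⁻¹ * (σ₁ ^ 3)⁻¹ * Δ ^ 2 * σ₁⁻¹, σ₁]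

/-- A factorization of `Δ²` with first factor `σ₁³` followed by three half-twists, with vectors
given for the latter. -/
structure IsCubeFactorization (a b c : B₃) (p q r s u v : ℤ) : Prop where
  fst : HasVector a p q
  snd : HasVector b r s
  trd : HasVector c u v
  prod : σ₁ ^ 3 * a * b * c = Δ ^ 2

namespace IsCubeFactorization

variable {a b c : B₃} {p q r s u v : ℤ}

theorem trace_eq (h : IsCubeFactorization a b c p q r s u v) :
    (p * s - q * r) ^ 2 + (r * v - s * u) ^ 2 + (p * v - q * u) ^ 2
      + (p * s - q * r) * (r * v - s * u) * (p * v - q * u) = 4 := by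
  have h1 : a * b * c = σ₁ ^ (-3 : ℤ) * Δ ^ 2 := by rw [← h.prod]; group
  have h2 := congrArg mat h1
  rw [mat_mul, mat_mul, mat_mul, h.fst.2, h.snd.2, h.trd.2, mat_σ₁_zpow, mat_Δ_sq,
    Matrix.one_fin_two] at h2
  simp at h2
  linear_combination -h2.1.1 - h2.2.2

theorem move_fst_left (h : IsCubeFactorization a b c p q r s u v) :
    IsCubeFactorization (a * b * a⁻¹) a c (r + (p * s - q * r) * p) (s + (p * s - q * r) * q)
      p q u v :=
  ⟨h.fst.conj_mul h.snd, h.fst, h.trd, by rw [← h.prod]; group⟩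

theorem move_fst_right (h : IsCubeFactorization a b c p q r s u v) :
    IsCubeFactorization b (b⁻¹ * a * b) c r s
      (p - (r * q - s * p) * r) (q - (r * q - s * p) * s) u v :=
  ⟨h.snd, h.snd.inv_conj_mul h.fst, h.trd, by rw [← h.prod]; group⟩

theorem move_snd_right (h : IsCubeFactorization a b c p q r s u v) :
    IsCubeFactorization a c (c⁻¹ * b * c) p q u v
      (r - (u * s - v * r) * u) (s - (u * s - v * r) * v) :=
  ⟨h.fst, h.trd, h.trd.inv_conj_mul h.snd, by rw [← h.prod]; group⟩

theorem hurwitz_of_eq_two (h : IsCubeFactorization a b c p q r s u v)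
    (hx : |p * s - q * r| = 2) : HurwitzEquivalent [σ₁ ^ 3, a, b, c] normalFactorization := by
  have hx2 : (p * s - q * r) ^ 2 = 4 := by rw [← sq_abs, hx]; norm_num
  -- The left trace is `2 - x² = -2`, the right one `3 * v ^ 2 - 2`.
  have hv : v = 0 := by
    have h1 : a * b = σ₁ ^ (-3 : ℤ) * Δ ^ 2 * c⁻¹ := by rw [← h.prod]; group
    have h2 := congrArg mat h1
    rw [mat_mul, mat_mul, mat_mul, mat_inv, h.fst.2, h.snd.2, h.trd.2, mat_σ₁_zpow, mat_Δ_sq,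
      Matrix.one_fin_two] at h2
    simp at h2
    have : v ^ 2 = 0 := by nlinarith [h2.1.1, h2.2.2]
    simpa using this
  have hc : c = σ₁ := h.trd.1.eq_σ₁ (by rw [h.trd.2]; simp [hv])
  subst hc
  -- With `c = σ₁` absorbed into the cube, traces give `2 = 4 * q ^ 2 - 2`.
  have hq : q ^ 2 = 1 := by
    have h1 : b = a⁻¹ * σ₁ ^ (-4 : ℤ) * Δ ^ 2 := by
      have h0 : b = a⁻¹ * (σ₁ ^ 3)⁻¹ * (Δ ^ 2 * σ₁⁻¹) := by rw [← h.prod]; group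
      rw [h0, (commute_Δ_sq σ₁⁻¹).eq]
      group
    have h2 := congrArg mat h1
    rw [mat_mul, mat_mul, mat_inv, h.fst.2, h.snd.2, mat_σ₁_zpow, mat_Δ_sq,
      Matrix.one_fin_two] at h2
    simp at h2
    linarith [h2.1.1, h2.2.2]
  -- Since `q² = 1`, the shear `σ₁ ^ n` sends `(p, q)` to `(0, q)`, a vector of `σ₂`.
  set n : ℤ := -(p * q) with hn
  have ha : σ₁ ^ n * a * (σ₁ ^ n)⁻¹ = σ₂ := by
    apply (h.fst.1.conj _).eq_σ₂
    rw [← zpow_neg, mat_mul, mat_mul, mat_σ₁_zpow, mat_σ₁_zpow, h.fst.2, mat_σ₂]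
    simp [hn]
    refine ⟨⟨?_, ?_⟩, ?_, ?_⟩
    · linear_combination p * q * hq
    · linear_combination (p ^ 2 * q ^ 2 - p ^ 2) * hq
    · simpa using hq
    · linear_combination -p * q * hq
  have hcenter : [σ₁ ^ 3, a, b, σ₁].prod ∈ Subgroup.center B₃ := by
    have : [σ₁ ^ 3, a, b, σ₁].prod = Δ ^ 2 := by rw [← h.prod]; simp [mul_assoc]
    rw [this]; exact Δ_sq_mem_center
  have hstep := HurwitzStep.conj _ (σ₁ ^ n) hcenter
  have hcb : σ₁ ^ n * b * (σ₁ ^ n)⁻¹ = σ₂⁻¹ * (σ₁ ^ 3)⁻¹ * Δ ^ 2 * σ₁⁻¹ := by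
    have hb : b = a⁻¹ * (σ₁ ^ 3)⁻¹ * Δ ^ 2 * σ₁⁻¹ := by rw [← h.prod]; group
    rw [← ha, hb]
    have := ((commute_Δ_sq (σ₁⁻¹ * (σ₁ ^ n)⁻¹)).eq)
    have e : (σ₁ ^ n * a * (σ₁ ^ n)⁻¹)⁻¹ * (σ₁ ^ 3)⁻¹ * Δ ^ 2 * σ₁⁻¹
        = (σ₁ ^ n * a * (σ₁ ^ n)⁻¹)⁻¹ * (σ₁ ^ 3)⁻¹ * (σ₁⁻¹ * Δ ^ 2) := by
      rw [mul_assoc _ (Δ ^ 2), (commute_Δ_sq σ₁⁻¹).eq]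
    rw [e, mul_assoc (σ₁ ^ n), mul_assoc _ σ₁⁻¹, mul_assoc _ (Δ ^ 2), this]
    group
  have e1 : σ₁ ^ n * σ₁ ^ 3 * (σ₁ ^ n)⁻¹ = σ₁ ^ 3 := by group
  have e2 : σ₁ ^ n * σ₁ * (σ₁ ^ n)⁻¹ = σ₁ := by group
  rw [List.map_cons, List.map_cons, List.map_cons, List.map_cons, List.map_nil, e1, e2, hcb, ha]
    at hstep
  exact Relation.ReflTransGen.single hstep

/-- Induction on `|x| + |y| + |z|`: up to sign and order, `step₁`, `step₂`, `step₃` replace `y`,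
`z`, `x` respectively by the other Vieta root. -/
theorem hurwitz_normalFactorization (h : IsCubeFactorization a b c p q r s u v) :
    HurwitzEquivalent [σ₁ ^ 3, a, b, c] normalFactorization := by
  have step₁ (a b c : B₃) :
      HurwitzEquivalent [σ₁ ^ 3, a, b, c] [σ₁ ^ 3, a * b * a⁻¹, a, c] :=
    .single (HurwitzStep.left [σ₁ ^ 3] [c] a b)
  have step₂ (a b c : B₃) :
      HurwitzEquivalent [σ₁ ^ 3, a, b, c] [σ₁ ^ 3, b, b⁻¹ * a * b, c] :=
    .single (HurwitzStep.right [σ₁ ^ 3] [c] a b)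
  have step₃ (a b c : B₃) :
      HurwitzEquivalent [σ₁ ^ 3, a, b, c] [σ₁ ^ 3, a, c, c⁻¹ * b * c] :=
    .single (HurwitzStep.right [σ₁ ^ 3, a] [] b c)
  have third {a b c : B₃} {p q r s u v : ℤ} (h : IsCubeFactorization a b c p q r s u v)
      (hz : |p * v - q * u| = 2) : HurwitzEquivalent [σ₁ ^ 3, a, b, c] normalFactorization :=
    (step₃ a b c).trans (h.move_snd_right.hurwitz_of_eq_two hz)
  have second {a b c : B₃} {p q r s u v : ℤ} (h : IsCubeFactorization a b c p q r s u v)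
      (hy : |r * v - s * u| = 2) : HurwitzEquivalent [σ₁ ^ 3, a, b, c] normalFactorization :=
    (step₂ a b c).trans (third h.move_fst_right hy)
  induction hn : (|p * s - q * r| + |r * v - s * u| + |p * v - q * u|).toNat
    using Nat.strong_induction_on generalizing a b c p q r s u v with
  | _ n ih =>
    have hm₁ := h.move_fst_left
    have hm₂ := h.move_fst_right
    have hm₃ := h.move_snd_right
    have ex₁ : |(r + (p * s - q * r) * p) * q - (s + (p * s - q * r) * q) * p| =
        |p * s - q * r| := by rw [← abs_neg]; ring_nf
    have ex₂ : |r * (q - (r * q - s * p) * s) - s * (p - (r * q - s * p) * r)| =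
        |p * s - q * r| := by rw [← abs_neg]; ring_nf
    have ex₃ : |u * (s - (u * s - v * r) * v) - v * (r - (u * s - v * r) * u)| =
        |r * v - s * u| := by rw [← abs_neg]; ring_nf
    have e₁ : (r + (p * s - q * r) * p) * v - (s + (p * s - q * r) * q) * u =
        (r * v - s * u) + (p * s - q * r) * (p * v - q * u) := by ring
    have e₂ : (p - (r * q - s * p) * r) * v - (q - (r * q - s * p) * s) * u =
        (p * v - q * u) + (p * s - q * r) * (r * v - s * u) := by ring
    have e₃ : p * (s - (u * s - v * r) * v) - q * (r - (u * s - v * r) * u) =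
        (p * s - q * r) + (r * v - s * u) * (p * v - q * u) := by ring
    have hx := abs_nonneg (p * s - q * r)
    have hy := abs_nonneg (r * v - s * u)
    have hz := abs_nonneg (p * v - q * u)
    rcases vieta_descent h.trace_eq with H | H | H | H | H | H | H | H
    · exact h.hurwitz_of_eq_two H
    · exact second h H
    · exact third h H
    · exact (step₂ a b c).trans (second hm₂ (by rw [e₂]; exact H))
    · exact (step₃ a b c).trans (third hm₃ (by rw [e₃]; exact H))
    · refine (step₂ a b c).trans (ih _ ?_ hm₂ rfl)
      have := (abs_nonneg _).trans_lt H
      rw [ex₂, e₂]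
      omega
    · refine (step₁ a b c).trans (ih _ ?_ hm₁ rfl)
      have := (abs_nonneg _).trans_lt H
      rw [ex₁, e₁]
      omega
    · refine (step₃ a b c).trans (ih _ ?_ hm₃ rfl)
      have := (abs_nonneg _).trans_lt H
      rw [ex₃, e₃]
      omega

end IsCubeFactorization

theorem hurwitzEquivalent_normalFactorization {F : List B₃} (hprod : F.prod = Δ ^ 2)
    {h₁ h₂ h₃ h₄ : B₃} (H₁ : IsPositiveHalfTwist h₁) (H₂ : IsPositiveHalfTwist h₂)
    (H₃ : IsPositiveHalfTwist h₃) (H₄ : IsPositiveHalfTwist h₄)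
    (hF : F.Perm [h₁ ^ 3, h₂, h₃, h₄]) : HurwitzEquivalent F normalFactorization := by
  obtain ⟨L, M, rfl⟩ := List.append_of_mem (hF.mem_iff.mpr List.mem_cons_self)
  have hLM : (L ++ M).Perm [h₂, h₃, h₄] := (List.perm_middle.symm.trans hF).cons_inv
  have hall : ∀ g ∈ L ++ M, IsPositiveHalfTwist g := by
    intro g hg
    have := hLM.mem_iff.mp hg
    simp only [List.mem_cons, List.not_mem_nil, or_false] at this
    rcases this with rfl | rfl | rfl <;> assumption
  obtain ⟨N, hN, hPN, hlen⟩ := HurwitzEquivalent.exists_move_to_front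
    (P := IsPositiveHalfTwist) (fun g h hg => hg.conj h) (h₁ ^ 3) L M
    (fun g hg => hall g (List.mem_append_left _ hg))
    (fun g hg => hall g (List.mem_append_right _ hg))
  rw [← List.length_append, hLM.length_eq] at hlen
  obtain ⟨a, b, c, rfl⟩ := List.length_eq_three.mp hlen
  obtain ⟨k, rfl⟩ := isConj_iff.mp H₁
  have hN' := hN.prod_eq.trans hprod
  have hstep := HurwitzStep.conj _ k⁻¹ (hN' ▸ Δ_sq_mem_center)
  have hprod' := hstep.prod_eq.trans hN'
  have e : k⁻¹ * (k * σ₁ * k⁻¹) ^ 3 * k⁻¹⁻¹ = σ₁ ^ 3 := by rw [conj_pow]; group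
  simp only [List.map_cons, List.map_nil, e] at hstep hprod'
  obtain ⟨p, q, ha⟩ := ((hPN a (by simp)).conj k⁻¹).exists_hasVector
  obtain ⟨r, s, hb⟩ := ((hPN b (by simp)).conj k⁻¹).exists_hasVector
  obtain ⟨u, v, hc⟩ := ((hPN c (by simp)).conj k⁻¹).exists_hasVector
  refine hN.trans (Relation.ReflTransGen.head hstep ?_)
  refine IsCubeFactorization.hurwitz_normalFactorization ⟨ha, hb, hc, ?_⟩
  rw [← hprod']
  simp only [List.prod_cons, List.prod_nil, mul_one, mul_assoc]

end Braid3

theorem mainTheorem8 (F : List Braid3.B₃)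
    (hprod : F.prod = Braid3.Δ ^ 2)
    (hfactors : ∃ h₁ h₂ h₃ h₄ : Braid3.B₃,
      Braid3.IsPositiveHalfTwist h₁ ∧ Braid3.IsPositiveHalfTwist h₂ ∧
      Braid3.IsPositiveHalfTwist h₃ ∧ Braid3.IsPositiveHalfTwist h₄ ∧
      F.Perm [h₁ ^ 3, h₂, h₃, h₄]) :
    HurwitzEquivalent F
      [Braid3.σ₁ ^ 3, Braid3.σ₁⁻¹ * Braid3.σ₂ * Braid3.σ₁, Braid3.σ₁, Braid3.σ₂] := by
  open Braid3 in
  obtain ⟨h₁, h₂, h₃, h₄, H₁, H₂, H₃, H₄, hF⟩ := hfactors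
  -- The target is itself of the given type, so it reduces to the same normal form, and that
  -- reduction is reversible.
  refine (hurwitzEquivalent_normalFactorization hprod H₁ H₂ H₃ H₄ hF).trans
    (hurwitzEquivalent_normalFactorization ?_ isPositiveHalfTwist_σ₁
      (by simpa using isPositiveHalfTwist_σ₂.conj σ₁⁻¹) isPositiveHalfTwist_σ₁
      isPositiveHalfTwist_σ₂ (List.Perm.refl _)).symm
  calc [σ₁ ^ 3, σ₁⁻¹ * σ₂ * σ₁, σ₁, σ₂].prod
      = σ₁ * (σ₁ * σ₂ * σ₁) * (σ₁ * σ₂) := by simp [pow_succ, mul_assoc]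
    _ = (σ₁ * σ₂) ^ 3 := by rw [braid_relation]; simp [pow_succ, mul_assoc]
    _ = Δ ^ 2 := σ₁_mul_σ₂_cube
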